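/- Let $\ell^2$ be the space of square summable complex sequences indexed by $0,1,2,\dots$, with canonical vectors $e_0,e_1,\dots$ and $\langle x,y\rangle=\sum_j x_j\overline{y_j}$. Let $A,B$ be tridiagonal infinite matrices with bounded complex entries, identified with bounded operators on $\ell^2$, and denote the diagonal entries of $zB-A$ by $\beta_n(z)$, the entries in row $n$, column $n+1$ by $-\alpha^R_n(z)$, and the entries in row $n+1$, column $n$ by $-\alpha^L_n(z)$ ($n\ge 0$). Suppose that none of the polynomials $\beta_n,\alpha^L_n,\alpha^R_n$ is identically zero. Define polynomials $q_n,p_n$ as the solutions of $$y_{n+1}=\beta_n(z)\,y_n-\alpha^L_{n-1}(z)\alpha^R_{n-1}(z)\,y_{n-1},\qquad n\ge 0,\qquad \alpha^L_{-1}=\alpha^R_{-1}=1,$$ with $q_0=1,\ q_{-1}=0,\ p_0=0,\ p_{-1}=-1$, and put $m_{[0:n]}=p_{n+1}/q_{n+1}$ for $n\ge -1$. Let $\rho(A,B)$ be the set of $z\in\mathbb C$ such that $zB-A$ has a bounded inverse, and $m(z)=\langle (zB-A)^{-1}e_0,e_0\rangle$ for $z\in\rho(A,B)$. Put $\Theta(B)=\{\langle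 By,y\rangle:\|y\|=1\}$ and $W(A,B)=\{z\in\mathbb C:\langle (zB-A)y,y\rangle=0\text{ for some }y\ne0\}$. For $E\subset\mathbb C$ let $\operatorname{cap}(E)$ be its logarithmic capacity, i.e. the supremum of $\exp\bigl(-\iint\log\frac1{|z-w|}\,d\mu(z)\,d\mu(w)\bigr)$ over the Borel probability measures $\mu$ supported on a compact subset of $E$ (and $0$ if $E$ is empty). Rational functions $f_n=P_n/Q_n$ are said to converge to $f$ in capacity in $V$ if, for each $\eta>0$, the capacity of the set of all $z\in V$ with $Q_n(z)=0$ or $|f(z)-f_n(z)|\ge\eta$ tends to $0$ as $n\to\infty$. **Theorem.** Let $V$ be a closed connected subset of $\mathbb C$ with compact boundary and $V\subset\rho(A,B)$; if $V$ is unbounded, suppose moreover that $\infty\in\rho(A,B)$, i.e. that $B$ has a bounded inverse. Then there exist $\epsilon_n\in\{0,1\}$, $n\ge 0$, such that no $q_{n+\epsilon_n}$ is identically zero and $m_{[0:n-1+\epsilon_n]}$ converges to $m$ in capacity in $V$. If, in addition, $0\notin\overline{\Theta(B)}$ and $V\not\subset\overline{W(A,B)}$, then no $q_n$ is identically zero and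 the whole sequence $m_{[0:n]}$ converges to $m$ in capacity in $V$. -/

import Mathlib

open Polynomial Filter Topology MeasureTheory
open scoped ENNReal InnerProductSpace

/-! Bounded tridiagonal linear pencils `z B - A` on `ℓ²`, their continued fractions, and
convergence in logarithmic capacity. -/

namespace Pencil

noncomputable section

/-- The Hilbert space of square summable complex sequences indexed by `0, 1, 2, …`. -/
abbrev Ell2 : Type := lp (fun _ : ℕ => ℂ) 2

/-- The canonical vector `e k`. -/
def e (k : ℕ) : Ell2 := lp.single 2 k (1 : ℂ)

/-- The matrix entry `⟨T e_k, e_j⟩` of a bounded operator (row `j`, column `k`). Mathlib's inner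
product is linear in the second argument. -/
def entry (T : Ell2 →L[ℂ] Ell2) (j k : ℕ) : ℂ := inner ℂ (e j) (T (e k))

/-- The matrix of `T` is tridiagonal. The tridiagonal matrices with bounded entries are exactly
the matrices of the bounded operators with this property. -/
def IsTridiagonal (T : Ell2 →L[ℂ] Ell2) : Prop :=
  ∀ j k : ℕ, j + 1 < k ∨ k + 1 < j → entry T j k = 0

/-- The diagonal entry `β_n(z)` of `z B - A`. -/
def beta (A B : Ell2 →L[ℂ] Ell2) (n : ℕ) : ℂ[X] :=
  C (entry B n n) * X - C (entry A n n)

/-- `-α^R_n(z)` is the entry of `z B - A` in row `n` and column `n + 1`. -/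
def alphaR (A B : Ell2 →L[ℂ] Ell2) (n : ℕ) : ℂ[X] :=
  -(C (entry B n (n + 1)) * X - C (entry A n (n + 1)))

/-- `-α^L_n(z)` is the entry of `z B - A` in row `n + 1` and column `n`. -/
def alphaL (A B : Ell2 →L[ℂ] Ell2) (n : ℕ) : ℂ[X] :=
  -(C (entry B (n + 1) n) * X - C (entry A (n + 1) n))

/-- The denominators `q_n`:
`y_{n+1} = β_n y_n - α^L_{n-1} α^R_{n-1} y_{n-1}` with `q_{-1} = 0`, `q_0 = 1`
(and `α^L_{-1} = α^R_{-1} = 1`), so that `q_1 = β_0`. -/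
def q (A B : Ell2 →L[ℂ] Ell2) : ℕ → ℂ[X]
  | 0 => 1
  | 1 => beta A B 0
  | n + 2 => beta A B (n + 1) * q A B (n + 1) - alphaL A B n * alphaR A B n * q A B n

/-- The numerators `p_n`: the same recurrence with `p_{-1} = -1`, `p_0 = 0`, so that `p_1 = 1`. -/
def p (A B : Ell2 →L[ℂ] Ell2) : ℕ → ℂ[X]
  | 0 => 0
  | 1 => 1
  | n + 2 => beta A B (n + 1) * p A B (n + 1) - alphaL A B n * alphaR A B n * p A B n

/-- The (finite part of the) resolvent set `ρ(A, B)` of the pencil: `z B - A` has a bounded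
inverse. -/
def resolventSet (A B : Ell2 →L[ℂ] Ell2) : Set ℂ := {z | IsUnit (z • B - A)}

/-- The `m`-function `m(z) = ⟨(z B - A)⁻¹ e_0, e_0⟩`; meaningful for `z ∈ ρ(A, B)`. -/
def mFun (A B : Ell2 →L[ℂ] Ell2) (z : ℂ) : ℂ :=
  inner ℂ (e 0) ((Ring.inverse (z • B - A) : Ell2 →L[ℂ] Ell2) (e 0))

/-- The numerical range `Θ(T)` of a bounded operator. -/
def Theta (T : Ell2 →L[ℂ] Ell2) : Set ℂ := {w | ∃ y : Ell2, ‖y‖ = 1 ∧ inner ℂ y (T y) = w}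

/-- The numerical range `W(A, B)` of the pencil. -/
def W (A B : Ell2 →L[ℂ] Ell2) : Set ℂ := {z | ∃ y : Ell2, y ≠ 0 ∧ inner ℂ y ((z • B - A) y) = 0}

/-- The logarithmic energy `∬ log (1 / |z - w|) dμ(z) dμ(w)`, as the difference of the integrals
of the positive and of the negative part of the integrand, which is `+∞` on the diagonal. The
second integral is finite if `μ` is finite with compact support. -/
def energy (μ : Measure ℂ) : EReal :=
  ((∫⁻ z, ∫⁻ w, (-ENNReal.log (edist z w)).toENNReal ∂μ ∂μ : ℝ≥0∞) : EReal) -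
    ((∫⁻ z, ∫⁻ w, (ENNReal.log (edist z w)).toENNReal ∂μ ∂μ : ℝ≥0∞) : EReal)

/-- The logarithmic capacity of a set: the supremum of `exp (-energy μ)` over the Borel
probability measures `μ` supported on a compact subset of `E`. -/
def capacity (E : Set ℂ) : ℝ≥0∞ :=
  ⨆ (μ : Measure ℂ) (_ : IsProbabilityMeasure μ) (_ : ∃ K ⊆ E, IsCompact K ∧ μ Kᶜ = 0),
    EReal.exp (-energy μ)

/-- The rational functions `P n / Q n` converge to `f` in capacity in `V`: for each `η > 0`, the
capacity of the set of the points of `V` where `|f - P n / Q n| < η` fails tends to zero. The zeros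
of `Q n` are counted among these points (if `Q n ≠ 0`, they are finitely many). -/
def TendstoInCapacity (P Q : ℕ → ℂ[X]) (f : ℂ → ℂ) (V : Set ℂ) : Prop :=
  ∀ η : ℝ, 0 < η →
    Tendsto (fun n => capacity {z ∈ V | (Q n).eval z = 0 ∨
      η ≤ ‖f z - (P n).eval z / (Q n).eval z‖}) atTop (𝓝 0)

end

end Pencil

/-! Write T = zB - A, let S be its inverse, and call the entries S_{jk}. Comparing entries in ST =
TS = 1 shows that the rows of S left of the diagonal and the columns above it solve the three-term
recurrence up to products of off-diagonal entries, while the first row and column carry the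
linearized errors q_k m - p_k. This gives m - p_n/q_n = S_{0n} S_{n0} / S_{nn}. With the
abbreviation o_n = -T_{n+1,n} S_{n,n+1} (`offDiag`), the errors of p_n/q_n and of p_{n+1}/q_{n+1}
have the same numerator -T_{n+1,n} S_{0,n+1} S_{n0}, over o_n and 1 + o_n respectively.

All numerators tend to zero locally uniformly, because the column S e_0 is in ℓ². The denominators
are locally bounded and equicontinuous, since entries are bounded by operator norms. If they stay
away from zero at one point z₀ of V, no limit function vanishes identically on the component
containing V, so it has finitely many zeros in a compact set. The bad points then lie in finitely
many small discs, together with the finitely many zeros of q_n, and have small capacity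
(`tendsto_capacity_of_normal`, `tendstoInCapacity_of_error_mul`).

Nondegeneracy at z₀: o_n and 1 + o_n cannot both be small, which dictates ε_n. Under the numerical
range hypotheses, S_{nn} is bounded below at a z₀ outside the closure of W(A,B), and no shift is
needed. Near infinity, invertibility of B supplies uniform estimates that exclude bad points there.
-/

namespace Pencil

/-! ### Capacity of sets covered by a finite set and small discs. -/

/-- The positive part of the logarithmic energy is bounded below by the mass of a set of small
diameter. -/
lemma le_lintegral_neg_log (μ : Measure ℂ) {S : Set ℂ} (hS : MeasurableSet S) {t : ℝ≥0∞}
    (ht : ∀ z ∈ S, ∀ w ∈ S, edist z w ≤ t) :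
    (-ENNReal.log t).toENNReal * μ S * μ S ≤
      ∫⁻ z, ∫⁻ w, (-ENNReal.log (edist z w)).toENNReal ∂μ ∂μ := by
  calc (-ENNReal.log t).toENNReal * μ S * μ S
      = ∫⁻ _ in S, ∫⁻ _ in S, (-ENNReal.log t).toENNReal ∂μ ∂μ := by
        simp [lintegral_const]
    _ ≤ ∫⁻ z in S, ∫⁻ w in S, (-ENNReal.log (edist z w)).toENNReal ∂μ ∂μ := by
        refine setLIntegral_mono' hS fun z hz => setLIntegral_mono' hS fun w hw => ?_
        exact EReal.toENNReal_le_toENNReal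
          (EReal.neg_le_neg_iff.2 (ENNReal.log_le_log (ht z hz w hw)))
    _ ≤ ∫⁻ z in S, ∫⁻ w, (-ENNReal.log (edist z w)).toENNReal ∂μ ∂μ :=
        lintegral_mono fun z => setLIntegral_le_lintegral _ _
    _ ≤ _ := setLIntegral_le_lintegral _ _

/-- The negative part of the logarithmic energy of a probability measure with bounded support is
bounded. -/
lemma lintegral_log_le (μ : Measure ℂ) [IsProbabilityMeasure μ] {K : Set ℂ} (hμ : μ Kᶜ = 0)
    {t : ℝ≥0∞} (ht : ∀ z ∈ K, ∀ w ∈ K, edist z w ≤ t) :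
    ∫⁻ z, ∫⁻ w, (ENNReal.log (edist z w)).toENNReal ∂μ ∂μ ≤ (ENNReal.log t).toENNReal := by
  have hK : ∀ᵐ z ∂μ, z ∈ K := hμ
  calc ∫⁻ z, ∫⁻ w, (ENNReal.log (edist z w)).toENNReal ∂μ ∂μ
      ≤ ∫⁻ _, ∫⁻ _, (ENNReal.log t).toENNReal ∂μ ∂μ := by
        refine lintegral_mono_ae ?_
        filter_upwards [hK] with z hz
        refine lintegral_mono_ae ?_
        filter_upwards [hK] with w hw
        exact EReal.toENNReal_le_toENNReal (ENNReal.log_le_log (ht z hz w hw))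
    _ = _ := by simp

lemma exists_measure_pos_of_finite (μ : Measure ℂ) {F : Set ℂ} (hF : F.Finite) (h : μ F ≠ 0) :
    ∃ x ∈ F, μ {x} ≠ 0 := by
  by_contra! hx
  exact h ((measure_null_iff_singleton hF.countable).2 hx)

lemma exists_le_measure_of_biUnion (μ : Measure ℂ) {Z : Finset ℂ} {S : ℂ → Set ℂ}
    (h : 1 ≤ μ (⋃ w ∈ Z, S w)) : ∃ w ∈ Z, (Z.card : ℝ≥0∞)⁻¹ ≤ μ (S w) := by
  by_contra! hx
  rcases Z.eq_empty_or_nonempty with rfl | hZ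
  · simp at h
  have h1 : μ (⋃ w ∈ Z, S w) ≤ ∑ w ∈ Z, μ (S w) := measure_biUnion_finset_le _ _
  have h2 : ∑ w ∈ Z, μ (S w) < ∑ _w ∈ Z, (Z.card : ℝ≥0∞)⁻¹ :=
    ENNReal.sum_lt_sum_of_nonempty hZ hx
  have h3 : ∑ _w ∈ Z, (Z.card : ℝ≥0∞)⁻¹ = 1 := by
    rw [Finset.sum_const, nsmul_eq_mul]
    exact ENNReal.mul_inv_cancel (by simpa using hZ.ne_empty) (by simp)
  exact absurd (h.trans h1) (not_le.2 (h3 ▸ h2))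

/-- A set which is covered, up to a finite set, by a fixed number of small discs has small
capacity. -/
lemma exists_capacity_le_of_subset_balls (Z : Finset ℂ) (ρ : ℝ) {ε : ℝ} (hε : 0 < ε) :
    ∃ s : ℝ, 0 < s ∧ ∀ E F : Set ℂ, F.Finite →
      E ⊆ F ∪ (Metric.closedBall 0 ρ ∩ ⋃ w ∈ Z, Metric.ball w s) →
      capacity E ≤ ENNReal.ofReal ε := by
  -- D bounds the diameter of the ball, with log D ≥ 0. M makes M - log D at least -log ε.
  set D : ℝ := max (2 * ρ) 1 with hD
  have hD1 : 1 ≤ D := le_max_right _ _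
  set N : ℝ := (Z.card : ℝ) with hN
  set M : ℝ := Real.log D + |Real.log ε| with hM
  have hM0 : 0 ≤ M := add_nonneg (Real.log_nonneg hD1) (abs_nonneg _)
  -- One of the N discs has mass at least 1/N, and its diameter is at most exp(-N²M). It therefore
  -- contributes at least N²M / N² = M to the energy.
  refine ⟨Real.exp (-(N * N * M)) / 2, by positivity, fun E F hF hE => ?_⟩
  refine iSup_le fun μ => iSup_le fun _ => iSup_le ?_
  rintro ⟨K, hKE, hK, hμK⟩
  by_cases hμF : μ F = 0
  · have hcov : μ (Metric.closedBall 0 ρ ∩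
        ⋃ w ∈ Z, Metric.ball w (Real.exp (-(N * N * M)) / 2))ᶜ = 0 := by
      refine measure_mono_null (t := Kᶜ ∪ F) (fun z hz => ?_) (measure_union_null hμK hμF)
      by_cases hzK : z ∈ K
      · exact Or.inr ((hE (hKE hzK)).resolve_right hz)
      · exact Or.inl hzK
    have hI2 := lintegral_log_le μ hcov (t := ENNReal.ofReal D) fun z hz w hw => by
      rw [edist_dist]
      apply ENNReal.ofReal_le_ofReal
      have h1 := Metric.mem_closedBall.1 hz.1
      have h2 := Metric.mem_closedBall'.1 hw.1
      have := dist_triangle z 0 w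
      exact le_trans (by linarith) (le_max_left _ _)
    have h1 : 1 ≤ μ (⋃ w ∈ Z, Metric.ball w (Real.exp (-(N * N * M)) / 2)) := by
      refine ge_of_eq ((prob_compl_eq_zero_iff
        (Z.measurableSet_biUnion fun w _ => measurableSet_ball)).1 ?_)
      exact measure_mono_null (Set.compl_subset_compl.2 Set.inter_subset_right) hcov
    obtain ⟨w, hwZ, hw⟩ := exists_le_measure_of_biUnion μ h1
    have hN1 : 1 ≤ N := by
      rw [hN]; exact_mod_cast Finset.card_pos.2 ⟨w, hwZ⟩
    have hI1 := le_lintegral_neg_log μ (measurableSet_ball)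
      (S := Metric.ball w (Real.exp (-(N * N * M)) / 2))
      (t := ENNReal.ofReal (Real.exp (-(N * N * M)))) fun z hz v hv => by
      rw [edist_dist]
      apply ENNReal.ofReal_le_ofReal
      have h1 := Metric.mem_ball.1 hz
      have h2 := Metric.mem_ball'.1 hv
      have := dist_triangle z w v
      linarith
    have hlog : (-ENNReal.log (ENNReal.ofReal (Real.exp (-(N * N * M))))).toENNReal =
        ENNReal.ofReal (N * N * M) := by
      rw [ENNReal.log_ofReal_of_pos (Real.exp_pos _), Real.log_exp, ← EReal.coe_neg, neg_neg,
        EReal.toENNReal_of_ne_top (EReal.coe_ne_top _), EReal.toReal_coe]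
    have hlogD : (ENNReal.log (ENNReal.ofReal D)).toENNReal = ENNReal.ofReal (Real.log D) := by
      rw [ENNReal.log_ofReal_of_pos (by linarith),
        EReal.toENNReal_of_ne_top (EReal.coe_ne_top _), EReal.toReal_coe]
    rw [hlogD] at hI2
    have hI1' : ENNReal.ofReal M ≤
        ∫⁻ z, ∫⁻ w, (-ENNReal.log (edist z w)).toENNReal ∂μ ∂μ := by
      refine le_trans ?_ hI1
      rw [hlog]
      have hNN : (Z.card : ℝ≥0∞)⁻¹ = ENNReal.ofReal N⁻¹ := by
        rw [ENNReal.ofReal_inv_of_pos (by linarith), hN, ENNReal.ofReal_natCast]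
      calc ENNReal.ofReal M = ENNReal.ofReal (N * N * M) * ENNReal.ofReal N⁻¹ *
            ENNReal.ofReal N⁻¹ := by
            rw [← ENNReal.ofReal_mul (by positivity), ← ENNReal.ofReal_mul (by positivity)]
            congr 1
            field_simp
        _ ≤ _ := by
            rw [hNN] at hw
            gcongr
    have hen : ((-Real.log ε : ℝ) : EReal) ≤ energy μ := by
      unfold energy
      calc ((-Real.log ε : ℝ) : EReal) ≤ ((M - Real.log D : ℝ) : EReal) := by
            have := neg_abs_le (Real.log ε)
            exact_mod_cast (by rw [hM]; linarith)
        _ = ((ENNReal.ofReal M : ℝ≥0∞) : EReal) - ((ENNReal.ofReal (Real.log D) : ℝ≥0∞) : EReal) := by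
            rw [EReal.coe_ennreal_ofReal, EReal.coe_ennreal_ofReal, max_eq_left hM0,
              max_eq_left (Real.log_nonneg hD1), EReal.coe_sub]
        _ ≤ _ := EReal.sub_le_sub (EReal.coe_ennreal_le_coe_ennreal_iff.2 hI1')
            (EReal.coe_ennreal_le_coe_ennreal_iff.2 hI2)
    calc EReal.exp (-energy μ) ≤ EReal.exp ((Real.log ε : ℝ) : EReal) := by
          apply EReal.exp_monotone
          rw [EReal.neg_le, ← EReal.coe_neg]
          exact hen
      _ = _ := by rw [EReal.exp_coe, Real.exp_log hε]
  -- A measure charging the finite set F has an atom, hence infinite energy, and contributes nothing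
  -- to the capacity.
  · obtain ⟨x, -, hx⟩ := exists_measure_pos_of_finite μ hF hμF
    have hI1 := le_lintegral_neg_log μ (measurableSet_singleton x) (t := 0)
      (by rintro z rfl w rfl; simp)
    have htop : ∫⁻ z, ∫⁻ w, (-ENNReal.log (edist z w)).toENNReal ∂μ ∂μ = ⊤ := by
      rw [eq_top_iff]
      refine le_trans (le_of_eq ?_) hI1
      simp [ENNReal.top_mul hx]
    obtain ⟨r, hr⟩ := hK.isBounded.subset_closedBall 0
    have hI2 := lintegral_log_le μ hμK (t := ENNReal.ofReal (max (2 * r) 1)) fun z hz w hw => by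
      rw [edist_dist]
      apply ENNReal.ofReal_le_ofReal
      have h1 := Metric.mem_closedBall.1 (hr hz)
      have h2 := Metric.mem_closedBall'.1 (hr hw)
      have := dist_triangle z 0 w
      exact le_trans (by linarith) (le_max_left _ _)
    have hfin : ∫⁻ z, ∫⁻ w, (ENNReal.log (edist z w)).toENNReal ∂μ ∂μ ≠ ⊤ := by
      refine ne_top_of_le_ne_top ?_ hI2
      rw [ENNReal.log_ofReal_of_pos (by positivity),
        EReal.toENNReal_of_ne_top (EReal.coe_ne_top _)]
      exact ENNReal.ofReal_ne_top
    have hen : energy μ = ⊤ := by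
      unfold energy
      rw [htop, EReal.coe_ennreal_top]
      lift (∫⁻ z, ∫⁻ w, (ENNReal.log (edist z w)).toENNReal ∂μ ∂μ) to NNReal using hfin with y
      exact EReal.top_sub_coe _
    rw [hen]
    simp


/-! ### Normal families and capacity. -/

/-- An equicontinuous family which converges pointwise on an open set converges locally
uniformly there. -/
lemma tendstoLocallyUniformlyOn_of_equicontinuousAt {f : ℕ → ℂ → ℂ} {g : ℂ → ℂ} {U : Set ℂ}
    (hU : IsOpen U) (hf : ∀ z ∈ U, EquicontinuousAt f z) {φ : Filter ℕ} [φ.NeBot]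
    (h : ∀ z ∈ U, Tendsto (fun n => f n z) φ (𝓝 (g z))) :
    TendstoLocallyUniformlyOn f g φ U := by
  rw [Metric.tendstoLocallyUniformlyOn_iff]
  intro ε hε z hz
  have h1 := (Metric.equicontinuousAt_iff_right.1 (hf z hz)) (ε / 3) (by positivity)
  refine ⟨{w | ∀ n, dist (f n z) (f n w) < ε / 3} ∩ U, mem_nhdsWithin_of_mem_nhds
    (inter_mem h1 (hU.mem_nhds hz)), ?_⟩
  filter_upwards [(Metric.tendsto_nhds.1 (h z hz)) (ε / 3) (by positivity)] with n hn w hw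
  have h2 : dist (g z) (g w) ≤ ε / 3 :=
    le_of_tendsto ((h z hz).dist (h w hw.2)) (Eventually.of_forall fun m => (hw.1 m).le)
  have h3 := hw.1 n
  have h4 := dist_triangle4 (g w) (g z) (f n z) (f n w)
  rw [dist_comm (g w) (g z), dist_comm (g z) (f n z)] at h4
  linarith

/-- **Montel's theorem** along an ultrafilter. -/
lemma exists_tendstoLocallyUniformlyOn {f : ℕ → ℂ → ℂ} {U : Set ℂ}
    (hU : IsOpen U) (hf : ∀ z ∈ U, EquicontinuousAt f z)
    (hb : ∀ z ∈ U, ∃ M : ℝ, ∀ n, ‖f n z‖ ≤ M) (φ : Ultrafilter ℕ) :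
    ∃ g : ℂ → ℂ, TendstoLocallyUniformlyOn f g φ U := by
  have : ∀ z, ∃ w, z ∈ U → Tendsto (fun n => f n z) φ (𝓝 w) := by
    intro z
    by_cases hz : z ∈ U
    · obtain ⟨M, hM⟩ := hb z hz
      obtain ⟨w, -, hw⟩ := (isCompact_closedBall (0 : ℂ) M).ultrafilter_le_nhds
        (φ.map fun n => f n z) (by
          rw [Ultrafilter.coe_map, le_principal_iff]
          exact Filter.mem_map.2 (Filter.univ_mem' fun n => by simpa using hM n))
      exact ⟨w, fun _ => hw⟩
    · exact ⟨0, fun h => absurd h hz⟩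
  choose g hg using this
  exact ⟨g, tendstoLocallyUniformlyOn_of_equicontinuousAt hU hf hg⟩

/-- Infinitely many zeros in K would accumulate in K, against the identity theorem. -/
lemma finite_zeros_of_analyticOnNhd {g : ℂ → ℂ} {U K : Set ℂ} (hg : AnalyticOnNhd ℂ g U)
    (hU : IsPreconnected U) (hK : IsCompact K) (hKU : K ⊆ U) {z₀ : ℂ} (hz₀ : z₀ ∈ U)
    (h : g z₀ ≠ 0) : {z ∈ K | g z = 0}.Finite := by
  by_contra hinf
  obtain ⟨x, hxK, hx⟩ := Set.Infinite.exists_accPt_of_subset_isCompact hinf hK fun z hz => hz.1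
  refine h (hg.eqOn_zero_of_preconnected_of_frequently_eq_zero hU (hKU hxK) ?_ hz₀)
  exact (accPt_iff_frequently_nhdsNE.1 hx).mono fun z hz => hz.2

/-- Let `f n` be a normal sequence of holomorphic functions in a domain which does not degenerate
at a point. Then the sets of the points of a compact set where `f n` is smaller than a null
sequence tend to zero in capacity. -/
theorem tendsto_capacity_of_normal {U : Set ℂ} (hU : IsOpen U) (hUc : IsPreconnected U)
    {f : ℕ → ℂ → ℂ} (hd : ∀ n, DifferentiableOn ℂ (f n) U)
    (hf : ∀ z ∈ U, EquicontinuousAt f z) (hb : ∀ z ∈ U, ∃ M : ℝ, ∀ n, ‖f n z‖ ≤ M)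
    {z₀ : ℂ} (hz₀ : z₀ ∈ U) {c : ℝ} (hc : 0 < c) (hfc : ∀ n, c ≤ ‖f n z₀‖)
    {K : Set ℂ} (hK : IsCompact K) (hKU : K ⊆ U) {g : ℕ → ℂ → ℝ}
    (hg : TendstoUniformlyOn g 0 atTop K) {F E : ℕ → Set ℂ} (hF : ∀ n, (F n).Finite)
    (hE : ∀ n, E n ⊆ F n ∪ {z ∈ K | ‖f n z‖ ≤ g n z}) :
    Tendsto (fun n => capacity (E n)) atTop (𝓝 0) := by
  -- Convergence is tested along ultrafilters, where normality yields a limit function without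
  -- passing to subsequences.
  refine (tendsto_iff_ultrafilter _ _ _).2 fun φ hφ => ?_
  obtain ⟨F₀, hF₀⟩ := exists_tendstoLocallyUniformlyOn hU hf hb φ
  have hF₀d := hF₀.differentiableOn (Eventually.of_forall hd) hU
  have hF₀z : F₀ z₀ ≠ 0 := by
    have := ge_of_tendsto (hF₀.tendsto_at hz₀).norm (Eventually.of_forall hfc)
    exact norm_pos_iff.1 (hc.trans_le this)
  have hfin := finite_zeros_of_analyticOnNhd (hF₀d.analyticOnNhd hU) hUc hK hKU hz₀ hF₀z
  obtain ⟨ρ, hρ⟩ := hK.isBounded.subset_closedBall 0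
  have key : ∀ ε : ℝ, 0 < ε → ∀ᶠ n in (φ : Filter ℕ), capacity (E n) ≤ ENNReal.ofReal ε := by
    intro ε hε
    obtain ⟨s, hs, hcap⟩ := exists_capacity_le_of_subset_balls hfin.toFinset ρ hε
    set B : Set ℂ := ⋃ w ∈ hfin.toFinset, Metric.ball w s with hB
    have hBo : IsOpen B := isOpen_biUnion fun w _ => Metric.isOpen_ball
    have hKB : IsCompact (K \ B) := hK.diff hBo
    obtain ⟨a, ha, hFa⟩ : ∃ a : ℝ, 0 < a ∧ ∀ z ∈ K \ B, a ≤ ‖F₀ z‖ := by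
      rcases (K \ B).eq_empty_or_nonempty with h | h
      · exact ⟨1, one_pos, by simp [h]⟩
      · obtain ⟨x, hx, hmin⟩ := hKB.exists_isMinOn h
          (((hF₀d.continuousOn.mono hKU).mono Set.sdiff_subset).norm)
        refine ⟨‖F₀ x‖, norm_pos_iff.2 fun h0 => hx.2 ?_, fun z hz => hmin hz⟩
        exact Set.mem_biUnion (hfin.mem_toFinset.2 ⟨hx.1, h0⟩) (Metric.mem_ball_self hs)
    have h1 := Metric.tendstoUniformlyOn_iff.1
      ((tendstoLocallyUniformlyOn_iff_forall_isCompact hU).1 hF₀ K hKU hK) (a / 3) (by positivity)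
    have h2 := hφ (Metric.tendstoUniformlyOn_iff.1 hg (a / 3) (by positivity))
    filter_upwards [h1, h2] with n hn1 hn2
    refine hcap _ (F n) (hF n) fun z hz => (hE n hz).imp id fun hz => ⟨hρ hz.1, ?_⟩
    -- Outside the discs the limit has modulus at least a, whereas a bad point would give it modulus
    -- below a/3 + a/3.
    by_contra hzB
    have h3 := hFa z ⟨hz.1, hzB⟩
    have h4 := hn1 z hz.1
    have h5 := hn2 z hz.1
    have h6 := hz.2
    rw [dist_eq_norm] at h4
    rw [Pi.zero_apply, dist_comm, Real.dist_eq, sub_zero] at h5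
    have h7 := le_abs_self (g n z)
    have h8 := norm_sub_norm_le (F₀ z) (f n z)
    linarith
  rw [ENNReal.tendsto_nhds_zero]
  intro ε hε
  by_cases htop : ε = ⊤
  · simp [htop]
  · filter_upwards [key ε.toReal (ENNReal.toReal_pos hε.ne' htop)] with n hn
    rwa [ENNReal.ofReal_toReal htop] at hn


/-! ### Matrix entries of tridiagonal operators and of products with them. -/

lemma inner_e_left (k : ℕ) (x : Ell2) : inner ℂ (e k) x = x k := by
  unfold e
  rw [lp.inner_single_left]
  simp

lemma norm_e (k : ℕ) : ‖e k‖ = 1 := by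
  unfold e
  rw [lp.norm_single (by norm_num)]
  simp

lemma e_apply (j k : ℕ) : e k j = if j = k then 1 else 0 := by
  unfold e
  rw [lp.single_apply]
  by_cases h : j = k <;> simp [h]

lemma entry_eq_apply (T : Ell2 →L[ℂ] Ell2) (j k : ℕ) : entry T j k = T (e k) j :=
  inner_e_left _ _

lemma norm_entry_le (T : Ell2 →L[ℂ] Ell2) (j k : ℕ) : ‖entry T j k‖ ≤ ‖T‖ := by
  unfold entry
  refine (norm_inner_le_norm _ _).trans ?_
  rw [norm_e, one_mul]
  simpa [norm_e] using T.le_opNorm (e k)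

lemma entry_one (j k : ℕ) : entry 1 j k = if j = k then 1 else 0 := by
  rw [entry_eq_apply]
  exact e_apply j k

lemma entry_sub (S T : Ell2 →L[ℂ] Ell2) (j k : ℕ) :
    entry (S - T) j k = entry S j k - entry T j k := by
  simp [entry]

lemma entry_smul (c : ℂ) (T : Ell2 →L[ℂ] Ell2) (j k : ℕ) :
    entry (c • T) j k = c * entry T j k := by
  simp [entry]

lemma entry_adjoint (T : Ell2 →L[ℂ] Ell2) (j k : ℕ) :
    entry (ContinuousLinearMap.adjoint T) j k = (starRingEnd ℂ) (entry T k j) := by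
  unfold entry
  rw [ContinuousLinearMap.adjoint_inner_right, inner_conj_symm]

lemma IsTridiagonal.adjoint {T : Ell2 →L[ℂ] Ell2} (hT : IsTridiagonal T) :
    IsTridiagonal (ContinuousLinearMap.adjoint T) := fun j k h => by
  rw [entry_adjoint, hT k j h.symm, map_zero]

lemma IsTridiagonal.pencil {A B : Ell2 →L[ℂ] Ell2} (hA : IsTridiagonal A) (hB : IsTridiagonal B)
    (z : ℂ) : IsTridiagonal (z • B - A) := fun j k h => by
  rw [entry_sub, entry_smul, hA j k h, hB j k h, mul_zero, sub_zero]

lemma IsTridiagonal.apply_e_zero {T : Ell2 →L[ℂ] Ell2} (hT : IsTridiagonal T) :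
    T (e 0) = entry T 0 0 • e 0 + entry T 1 0 • e 1 := by
  ext j
  rw [← entry_eq_apply]
  simp only [lp.coeFn_add, lp.coeFn_smul, Pi.add_apply, Pi.smul_apply, e_apply, smul_eq_mul]
  match j with
  | 0 => simp
  | 1 => simp
  | j + 2 => simpa using hT (j + 2) 0 (by omega)

lemma IsTridiagonal.apply_e_succ {T : Ell2 →L[ℂ] Ell2} (hT : IsTridiagonal T) (k : ℕ) :
    T (e (k + 1)) = entry T k (k + 1) • e k + entry T (k + 1) (k + 1) • e (k + 1) +
      entry T (k + 2) (k + 1) • e (k + 2) := by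
  ext j
  rw [← entry_eq_apply]
  simp only [lp.coeFn_add, lp.coeFn_smul, Pi.add_apply, Pi.smul_apply, e_apply, smul_eq_mul]
  by_cases h0 : j = k
  · subst h0; simp
  by_cases h1 : j = k + 1
  · subst h1; simp
  by_cases h2 : j = k + 2
  · subst h2; simp
  simpa [h0, h1, h2] using hT j (k + 1) (by omega)

lemma IsTridiagonal.entry_mul_zero {T : Ell2 →L[ℂ] Ell2} (hT : IsTridiagonal T)
    (S : Ell2 →L[ℂ] Ell2) (j : ℕ) :
    entry (S * T) j 0 = entry S j 0 * entry T 0 0 + entry S j 1 * entry T 1 0 := by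
  rw [entry, mul_apply_eq_comp, hT.apply_e_zero]
  simp only [map_add, map_smul, inner_add_right, inner_smul_right, ← entry.eq_1]
  ring

lemma IsTridiagonal.entry_mul_succ {T : Ell2 →L[ℂ] Ell2} (hT : IsTridiagonal T)
    (S : Ell2 →L[ℂ] Ell2) (j k : ℕ) :
    entry (S * T) j (k + 1) = entry S j k * entry T k (k + 1) +
      entry S j (k + 1) * entry T (k + 1) (k + 1) +
      entry S j (k + 2) * entry T (k + 2) (k + 1) := by
  rw [entry, mul_apply_eq_comp, hT.apply_e_succ]
  simp only [map_add, map_smul, inner_add_right, inner_smul_right, ← entry.eq_1]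
  ring

/-- Turns the formulas for right multiplication by a tridiagonal operator into those for left
multiplication. -/
lemma entry_mul_eq_adjoint (S T : Ell2 →L[ℂ] Ell2) (j k : ℕ) :
    entry (T * S) j k = (starRingEnd ℂ) (entry (ContinuousLinearMap.adjoint S *
      ContinuousLinearMap.adjoint T) k j) := by
  have h : ContinuousLinearMap.adjoint S * ContinuousLinearMap.adjoint T =
      ContinuousLinearMap.adjoint (T * S) := (ContinuousLinearMap.adjoint_comp T S).symm
  rw [h, entry_adjoint, Complex.conj_conj]

lemma IsTridiagonal.entry_zero_mul {T : Ell2 →L[ℂ] Ell2} (hT : IsTridiagonal T)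
    (S : Ell2 →L[ℂ] Ell2) (k : ℕ) :
    entry (T * S) 0 k = entry T 0 0 * entry S 0 k + entry T 0 1 * entry S 1 k := by
  rw [entry_mul_eq_adjoint, hT.adjoint.entry_mul_zero]
  simp only [entry_adjoint, map_add, map_mul, Complex.conj_conj]
  ring

lemma IsTridiagonal.entry_succ_mul {T : Ell2 →L[ℂ] Ell2} (hT : IsTridiagonal T)
    (S : Ell2 →L[ℂ] Ell2) (j k : ℕ) :
    entry (T * S) (j + 1) k = entry T (j + 1) j * entry S j k +
      entry T (j + 1) (j + 1) * entry S (j + 1) k +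
      entry T (j + 1) (j + 2) * entry S (j + 2) k := by
  rw [entry_mul_eq_adjoint, hT.adjoint.entry_mul_succ]
  simp only [entry_adjoint, map_add, map_mul, Complex.conj_conj]
  ring

/-! ### Resolvent entries, the recurrence and the error formulas. -/

section Pointwise

variable {A B : Ell2 →L[ℂ] Ell2} {z : ℂ}

lemma eval_beta (n : ℕ) : (beta A B n).eval z = entry (z • B - A) n n := by
  simp only [beta, eval_sub, eval_mul, eval_C, eval_X, entry_sub, entry_smul]
  ring

lemma eval_alphaR (n : ℕ) : (alphaR A B n).eval z = -entry (z • B - A) n (n + 1) := by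
  simp only [alphaR, eval_neg, eval_sub, eval_mul, eval_C, eval_X, entry_sub, entry_smul]
  ring

lemma eval_alphaL (n : ℕ) : (alphaL A B n).eval z = -entry (z • B - A) (n + 1) n := by
  simp only [alphaL, eval_neg, eval_sub, eval_mul, eval_C, eval_X, entry_sub, entry_smul]
  ring

/-- The products `α_0 ⋯ α_{n-1}` of the lower off-diagonal polynomials. -/
noncomputable def prodL (A B : Ell2 →L[ℂ] Ell2) (n : ℕ) : ℂ[X] :=
  ∏ j ∈ Finset.range n, alphaL A B j

/-- The products `α_0 ⋯ α_{n-1}` of the upper off-diagonal polynomials. -/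
noncomputable def prodR (A B : Ell2 →L[ℂ] Ell2) (n : ℕ) : ℂ[X] :=
  ∏ j ∈ Finset.range n, alphaR A B j

lemma eval_prodL_zero : (prodL A B 0).eval z = 1 := by simp [prodL]
lemma eval_prodR_zero : (prodR A B 0).eval z = 1 := by simp [prodR]
lemma eval_prodL_succ (n : ℕ) : (prodL A B (n + 1)).eval z =
    (prodL A B n).eval z * (alphaL A B n).eval z := by simp [prodL, Finset.prod_range_succ]
lemma eval_prodR_succ (n : ℕ) : (prodR A B (n + 1)).eval z =
    (prodR A B n).eval z * (alphaR A B n).eval z := by simp [prodR, Finset.prod_range_succ]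

lemma eval_q_add_two (n : ℕ) : (q A B (n + 2)).eval z =
    (beta A B (n + 1)).eval z * (q A B (n + 1)).eval z -
      (alphaL A B n).eval z * (alphaR A B n).eval z * (q A B n).eval z := by
  simp [q]

lemma eval_p_add_two (n : ℕ) : (p A B (n + 2)).eval z =
    (beta A B (n + 1)).eval z * (p A B (n + 1)).eval z -
      (alphaL A B n).eval z * (alphaR A B n).eval z * (p A B n).eval z := by
  simp [p]

/-- The rows of the resolvent left of the diagonal. -/
lemma prodL_mul_entry (hA : IsTridiagonal A) (hB : IsTridiagonal B) {S : Ell2 →L[ℂ] Ell2}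
    (hS : S * (z • B - A) = 1) (n : ℕ) : ∀ k ≤ n,
    (prodL A B k).eval z * entry S n k = (q A B k).eval z * entry S n 0 := by
  have hT := hA.pencil hB z
  intro k
  induction k using Nat.twoStepInduction with
  | zero => intro _; simp [eval_prodL_zero, q]
  | one =>
    intro hn
    have h := hT.entry_mul_zero S n
    rw [hS, entry_one, if_neg (by omega)] at h
    rw [eval_prodL_succ, eval_prodL_zero, eval_alphaL, q, eval_beta]
    linear_combination h
  | more k ih1 ih2 =>
    intro hn
    -- The entry of S T = 1 at (n, k + 1) is off the diagonal because k + 2 ≤ n, so row n of S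
    -- satisfies a homogeneous recurrence.
    have h := hT.entry_mul_succ S n k
    rw [hS, entry_one, if_neg (by omega)] at h
    have h1 := ih1 (by omega)
    have h2 := ih2 (by omega)
    rw [eval_prodL_succ] at h2
    rw [eval_q_add_two, eval_prodL_succ, eval_prodL_succ]
    simp only [eval_alphaL, eval_alphaR, eval_beta] at *
    linear_combination (prodL A B k).eval z * (-entry (z • B - A) (k + 1) k) * h +
      entry (z • B - A) (k + 1) (k + 1) * h2 -
      entry (z • B - A) (k + 1) k * entry (z • B - A) k (k + 1) * h1

/-- The columns of the resolvent above the diagonal. -/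
lemma prodR_mul_entry (hA : IsTridiagonal A) (hB : IsTridiagonal B) {S : Ell2 →L[ℂ] Ell2}
    (hS : (z • B - A) * S = 1) (n : ℕ) : ∀ k ≤ n,
    (prodR A B k).eval z * entry S k n = (q A B k).eval z * entry S 0 n := by
  have hT := hA.pencil hB z
  intro k
  induction k using Nat.twoStepInduction with
  | zero => intro _; simp [eval_prodR_zero, q]
  | one =>
    intro hn
    have h := hT.entry_zero_mul S n
    rw [hS, entry_one, if_neg (by omega)] at h
    rw [eval_prodR_succ, eval_prodR_zero, eval_alphaR, q, eval_beta]
    linear_combination h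
  | more k ih1 ih2 =>
    intro hn
    have h := hT.entry_succ_mul S k n
    rw [hS, entry_one, if_neg (by omega)] at h
    have h1 := ih1 (by omega)
    have h2 := ih2 (by omega)
    rw [eval_prodR_succ] at h2
    rw [eval_q_add_two, eval_prodR_succ, eval_prodR_succ]
    simp only [eval_alphaL, eval_alphaR, eval_beta] at *
    linear_combination (prodR A B k).eval z * (-entry (z • B - A) k (k + 1)) * h +
      entry (z • B - A) (k + 1) (k + 1) * h2 -
      entry (z • B - A) (k + 1) k * entry (z • B - A) k (k + 1) * h1

/-- The first row of the resolvent in terms of the linearized error. -/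
lemma prodL_mul_entry_zero (hA : IsTridiagonal A) (hB : IsTridiagonal B) {S : Ell2 →L[ℂ] Ell2}
    (hS : S * (z • B - A) = 1) (k : ℕ) : (prodL A B k).eval z * entry S 0 k =
      (q A B k).eval z * entry S 0 0 - (p A B k).eval z := by
  have hT := hA.pencil hB z
  induction k using Nat.twoStepInduction with
  | zero => simp [eval_prodL_zero, q, p]
  | one =>
    -- The only inhomogeneous equation is at (0, 0); its right-hand side 1 is the source of p_1 = 1.
    have h := hT.entry_mul_zero S 0
    rw [hS, entry_one, if_pos rfl] at h
    rw [eval_prodL_succ, eval_prodL_zero, eval_alphaL, q, eval_beta, p, eval_one]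
    linear_combination h
  | more k h1 h2 =>
    have h := hT.entry_mul_succ S 0 k
    rw [hS, entry_one, if_neg (by omega)] at h
    rw [eval_prodL_succ] at h2
    rw [eval_q_add_two, eval_p_add_two, eval_prodL_succ, eval_prodL_succ]
    simp only [eval_alphaL, eval_alphaR, eval_beta] at *
    linear_combination (prodL A B k).eval z * (-entry (z • B - A) (k + 1) k) * h +
      entry (z • B - A) (k + 1) (k + 1) * h2 -
      entry (z • B - A) (k + 1) k * entry (z • B - A) k (k + 1) * h1

/-- The first column of the resolvent in terms of the linearized error. -/
lemma prodR_mul_entry_zero (hA : IsTridiagonal A) (hB : IsTridiagonal B) {S : Ell2 →L[ℂ] Ell2}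
    (hS : (z • B - A) * S = 1) (k : ℕ) : (prodR A B k).eval z * entry S k 0 =
      (q A B k).eval z * entry S 0 0 - (p A B k).eval z := by
  have hT := hA.pencil hB z
  induction k using Nat.twoStepInduction with
  | zero => simp [eval_prodR_zero, q, p]
  | one =>
    have h := hT.entry_zero_mul S 0
    rw [hS, entry_one, if_pos rfl] at h
    rw [eval_prodR_succ, eval_prodR_zero, eval_alphaR, q, eval_beta, p, eval_one]
    linear_combination h
  | more k h1 h2 =>
    have h := hT.entry_succ_mul S k 0
    rw [hS, entry_one, if_neg (by omega)] at h
    rw [eval_prodR_succ] at h2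
    rw [eval_q_add_two, eval_p_add_two, eval_prodR_succ, eval_prodR_succ]
    simp only [eval_alphaL, eval_alphaR, eval_beta] at *
    linear_combination (prodR A B k).eval z * (-entry (z • B - A) k (k + 1)) * h +
      entry (z • B - A) (k + 1) (k + 1) * h2 -
      entry (z • B - A) (k + 1) k * entry (z • B - A) k (k + 1) * h1

/-- The quantity which controls the error of the `n`-th convergent: the product of the entries of
the pencil in position `(n + 1, n)` and of the resolvent in position `(n, n + 1)`, up to sign. -/
noncomputable def offDiag (A B : Ell2 →L[ℂ] Ell2) (n : ℕ) (z : ℂ) : ℂ :=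
  -(entry (z • B - A) (n + 1) n * entry (Ring.inverse (z • B - A)) n (n + 1))

/-- The diagonal entries of the resolvent. -/
noncomputable def diag (A B : Ell2 →L[ℂ] Ell2) (n : ℕ) (z : ℂ) : ℂ :=
  entry (Ring.inverse (z • B - A)) n n

/-- The common numerator of the error formulas involving `offDiag`. -/
noncomputable def offDiagNum (A B : Ell2 →L[ℂ] Ell2) (n : ℕ) (z : ℂ) : ℂ :=
  -(entry (z • B - A) (n + 1) n * entry (Ring.inverse (z • B - A)) 0 (n + 1)) *
    entry (Ring.inverse (z • B - A)) n 0

/-- The numerator of the error formula involving `diag`. -/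
noncomputable def diagNum (A B : Ell2 →L[ℂ] Ell2) (n : ℕ) (z : ℂ) : ℂ :=
  entry (Ring.inverse (z • B - A)) 0 n * entry (Ring.inverse (z • B - A)) n 0

variable (hA : IsTridiagonal A) (hB : IsTridiagonal B) (hz : z ∈ resolventSet A B)
include hA hB hz

/-- Multiplied form of m - p_n/q_n = S_{0n} S_{n0} / S_{nn}, which remains meaningful at the zeros
of q_n and of S_{nn}. -/
lemma error_mul_diag (n : ℕ) :
    ((q A B n).eval z * mFun A B z - (p A B n).eval z) * diag A B n z =
      (q A B n).eval z * diagNum A B n z := by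
  have h1 := prodR_mul_entry_zero hA hB (Ring.mul_inverse_cancel _ hz) n
  have h2 := prodR_mul_entry hA hB (Ring.mul_inverse_cancel _ hz) n n le_rfl
  rw [mFun, ← entry.eq_1, diag, diagNum]
  linear_combination -entry (Ring.inverse (z • B - A)) n n * h1 +
    entry (Ring.inverse (z • B - A)) n 0 * h2

lemma prodL_mul_diag (n : ℕ) : (prodL A B n).eval z * diag A B n z =
    (q A B n).eval z * entry (Ring.inverse (z • B - A)) n 0 :=
  prodL_mul_entry hA hB (Ring.inverse_mul_cancel _ hz) n n le_rfl

lemma prodR_mul_offDiag (n : ℕ) : (prodR A B n).eval z * offDiag A B n z =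
    (q A B n).eval z * -(entry (z • B - A) (n + 1) n *
      entry (Ring.inverse (z • B - A)) 0 (n + 1)) := by
  have h := prodR_mul_entry hA hB (Ring.mul_inverse_cancel _ hz) (n + 1) n (by omega)
  rw [offDiag]
  linear_combination -entry (z • B - A) (n + 1) n * h

lemma error_mul_offDiag (n : ℕ) :
    ((q A B n).eval z * mFun A B z - (p A B n).eval z) * offDiag A B n z =
      (q A B n).eval z * offDiagNum A B n z := by
  have h1 := prodR_mul_entry_zero hA hB (Ring.mul_inverse_cancel _ hz) n
  have h2 := prodR_mul_offDiag hA hB hz n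
  rw [mFun, ← entry.eq_1, offDiagNum]
  linear_combination -offDiag A B n z * h1 + entry (Ring.inverse (z • B - A)) n 0 * h2

/-- The diagonal entry (n, n) of S T = 1 expresses 1 + o_n through entries of row n of S in columns
up to n, which are multiples of S_{n0}; the recurrence assembles the coefficients into q_{n+1}. -/
lemma prodL_mul_one_add_offDiag (n : ℕ) : (prodL A B n).eval z * (1 + offDiag A B n z) =
    (q A B (n + 1)).eval z * entry (Ring.inverse (z • B - A)) n 0 := by
  have hT := hA.pencil hB z
  have hS := Ring.inverse_mul_cancel _ hz
  rw [offDiag]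
  cases n with
  | zero =>
    have h := hT.entry_mul_zero (Ring.inverse (z • B - A)) 0
    rw [hS, entry_one, if_pos rfl] at h
    rw [eval_prodL_zero, q, eval_beta]
    linear_combination h
  | succ k =>
    have h := hT.entry_mul_succ (Ring.inverse (z • B - A)) (k + 1) k
    rw [hS, entry_one, if_pos rfl] at h
    have h1 := prodL_mul_entry hA hB hS (k + 1) k (by omega)
    have h2 := prodL_mul_entry hA hB hS (k + 1) (k + 1) le_rfl
    rw [eval_q_add_two]
    rw [eval_prodL_succ] at *
    simp only [eval_alphaL, eval_alphaR, eval_beta] at *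
    linear_combination (prodL A B k).eval z * (-entry (z • B - A) (k + 1) k) * h +
      entry (z • B - A) (k + 1) (k + 1) * h2 -
      entry (z • B - A) (k + 1) k * entry (z • B - A) k (k + 1) * h1

/-- The numerator agrees with the one in `error_mul_offDiag`, so that passing from index n to n + 1
only replaces the denominator o_n by 1 + o_n. -/
lemma error_mul_one_add_offDiag (n : ℕ) :
    ((q A B (n + 1)).eval z * mFun A B z - (p A B (n + 1)).eval z) * (1 + offDiag A B n z) =
      (q A B (n + 1)).eval z * offDiagNum A B n z := by
  have h1 := prodL_mul_entry_zero hA hB (Ring.inverse_mul_cancel _ hz) (n + 1)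
  have h2 := prodL_mul_one_add_offDiag hA hB hz n
  rw [eval_prodL_succ, eval_alphaL] at h1
  rw [mFun, ← entry.eq_1, offDiagNum]
  linear_combination -(1 + offDiag A B n z) * h1 -
    entry (z • B - A) (n + 1) n * entry (Ring.inverse (z • B - A)) 0 (n + 1) * h2

end Pointwise


/-! ### Analyticity, equicontinuity and bounds on the resolvent set. -/

variable {A B : Ell2 →L[ℂ] Ell2}

lemma differentiable_pencil : Differentiable ℂ fun z : ℂ => z • B - A := by fun_prop

lemma differentiableAt_inverse_pencil {z : ℂ} (hz : z ∈ resolventSet A B) :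
    DifferentiableAt ℂ (fun z : ℂ => Ring.inverse (z • B - A)) z :=
  DifferentiableAt.fun_comp' z (differentiableAt_inverse (𝕜 := ℂ) hz) (differentiable_pencil z)

lemma isOpen_resolventSet : IsOpen (resolventSet A B) :=
  Units.isOpen.preimage (differentiable_pencil (A := A) (B := B)).continuous

lemma differentiableAt_entry {F : ℂ → Ell2 →L[ℂ] Ell2} {z : ℂ} (hF : DifferentiableAt ℂ F z)
    (j k : ℕ) : DifferentiableAt ℂ (fun z => entry (F z) j k) z := by
  have h : DifferentiableAt ℂ (fun z => innerSL ℂ (e j) (F z (e k))) z :=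
    (innerSL ℂ (e j)).differentiableAt.comp z (hF.clm_apply (differentiableAt_const _))
  exact h

lemma differentiableAt_diag {z : ℂ} (hz : z ∈ resolventSet A B) (n : ℕ) :
    DifferentiableAt ℂ (diag A B n) z :=
  differentiableAt_entry (differentiableAt_inverse_pencil hz) n n

lemma differentiableAt_offDiag {z : ℂ} (hz : z ∈ resolventSet A B) (n : ℕ) :
    DifferentiableAt ℂ (offDiag A B n) z :=
  ((differentiableAt_entry (differentiable_pencil z) (n + 1) n).mul
    (differentiableAt_entry (differentiableAt_inverse_pencil hz) n (n + 1))).neg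

lemma norm_entry_mul_entry_le (S T : Ell2 →L[ℂ] Ell2) (i j k l : ℕ) :
    ‖entry S i j * entry T k l‖ ≤ ‖S‖ * ‖T‖ := by
  rw [norm_mul]
  gcongr <;> exact norm_entry_le _ _ _

lemma norm_entry_mul_sub_le (S T S' T' : Ell2 →L[ℂ] Ell2) (i j k l : ℕ) :
    ‖entry S i j * entry T k l - entry S' i j * entry T' k l‖ ≤
      ‖S - S'‖ * ‖T‖ + ‖S'‖ * ‖T - T'‖ := by
  have : entry S i j * entry T k l - entry S' i j * entry T' k l =
      entry (S - S') i j * entry T k l + entry S' i j * entry (T - T') k l := by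
    rw [entry_sub, entry_sub]; ring
  rw [this]
  exact (norm_add_le _ _).trans
    (add_le_add (norm_entry_mul_entry_le _ _ _ _ _ _) (norm_entry_mul_entry_le _ _ _ _ _ _))

lemma tendsto_norm_sub_mul_add {ι : Type*} {l : Filter ι} {S T : ι → Ell2 →L[ℂ] Ell2}
    {S' T' : Ell2 →L[ℂ] Ell2} (hS : Tendsto S l (𝓝 S')) (hT : Tendsto T l (𝓝 T')) :
    Tendsto (fun x => ‖S x - S'‖ * ‖T x‖ + ‖S'‖ * ‖T x - T'‖) l (𝓝 0) := by
  have h1 := (tendsto_iff_norm_sub_tendsto_zero.1 hS).mul hT.norm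
  have h2 := (tendsto_iff_norm_sub_tendsto_zero.1 hT).const_mul ‖S'‖
  simpa using h1.add h2

/-- The operator norm of the difference of two resolvents is a modulus of continuity common to all
entries. -/
lemma equicontinuousAt_entry_inverse {z : ℂ} (hz : z ∈ resolventSet A B) (j k : ℕ → ℕ) :
    EquicontinuousAt (fun n (w : ℂ) => entry (Ring.inverse (w • B - A)) (j n) (k n)) z := by
  have h := tendsto_iff_norm_sub_tendsto_zero.1
    (differentiableAt_inverse_pencil hz).continuousAt.tendsto
  refine Metric.equicontinuousAt_of_continuity_modulus _ h _ (Eventually.of_forall fun w n => ?_)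
  rw [dist_comm, dist_eq_norm, ← entry_sub]
  exact norm_entry_le _ _ _

/-- The constants `a n` leave room for the shifts ε_n; they cancel in differences. -/
lemma equicontinuousAt_add_offDiag {z : ℂ} (hz : z ∈ resolventSet A B) (a : ℕ → ℂ) :
    EquicontinuousAt (fun n w => a n + offDiag A B n w) z := by
  have h := tendsto_norm_sub_mul_add (differentiable_pencil (A := A) (B := B)
    z).continuousAt.tendsto (differentiableAt_inverse_pencil hz).continuousAt.tendsto
  refine Metric.equicontinuousAt_of_continuity_modulus _ h _ (Eventually.of_forall fun w n => ?_)
  rw [dist_comm, dist_eq_norm, add_sub_add_left_eq_sub, offDiag, offDiag, neg_sub_neg,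
    norm_sub_rev]
  exact norm_entry_mul_sub_le _ _ _ _ _ _ _ _

lemma norm_offDiag_le (n : ℕ) (z : ℂ) :
    ‖offDiag A B n z‖ ≤ ‖z • B - A‖ * ‖Ring.inverse (z • B - A)‖ := by
  rw [offDiag, norm_neg]
  exact norm_entry_mul_entry_le _ _ _ _ _ _

lemma norm_diag_le (n : ℕ) (z : ℂ) : ‖diag A B n z‖ ≤ ‖Ring.inverse (z • B - A)‖ :=
  norm_entry_le _ _ _

lemma norm_offDiagNum_le (n : ℕ) (z : ℂ) :
    ‖offDiagNum A B n z‖ ≤ ‖z • B - A‖ * ‖Ring.inverse (z • B - A)‖ *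
      ‖entry (Ring.inverse (z • B - A)) n 0‖ := by
  rw [offDiagNum, norm_mul, norm_neg]
  gcongr
  exact norm_entry_mul_entry_le _ _ _ _ _ _

lemma norm_diagNum_le (n : ℕ) (z : ℂ) :
    ‖diagNum A B n z‖ ≤ ‖Ring.inverse (z • B - A)‖ *
      ‖entry (Ring.inverse (z • B - A)) n 0‖ := by
  rw [diagNum, norm_mul]
  gcongr
  exact norm_entry_le _ _ _

lemma tendsto_entry_zero (T : Ell2 →L[ℂ] Ell2) :
    Tendsto (fun n => entry T n 0) atTop (𝓝 0) := by
  have h := (lp.memℓp (T (e 0))).summable (by norm_num)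
  have h1 := h.tendsto_atTop_zero
  simp only [ENNReal.toReal_ofNat, Real.rpow_ofNat] at h1
  refine tendsto_zero_iff_norm_tendsto_zero.2 ?_
  have h2 := h1.sqrt
  simpa [Real.sqrt_sq, entry_eq_apply] using h2

/-- The first column of the resolvent tends to zero uniformly on compact sets, and so does every
sequence which it dominates. -/
lemma tendstoUniformlyOn_of_norm_le {K : Set ℂ} (hK : IsCompact K) (hKρ : K ⊆ resolventSet A B)
    {κ : ℕ → ℂ → ℂ} {C : ℂ → ℝ} (hC : ContinuousOn C K)
    (hκ : ∀ n z, ‖κ n z‖ ≤ C z * ‖entry (Ring.inverse (z • B - A)) n 0‖) :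
    TendstoUniformlyOn κ 0 atTop K := by
  have h := (tendstoLocallyUniformlyOn_iff_forall_isCompact isOpen_resolventSet).1
    (tendstoLocallyUniformlyOn_of_equicontinuousAt (φ := atTop) (g := 0) isOpen_resolventSet
      (fun z (hz : z ∈ resolventSet A B) => equicontinuousAt_entry_inverse hz id fun _ => 0)
      fun z _ => tendsto_entry_zero _) K hKρ hK
  obtain ⟨M, hM⟩ := hK.exists_bound_of_continuousOn hC
  rw [Metric.tendstoUniformlyOn_iff] at h ⊢
  intro ε hε
  filter_upwards [h (ε / (|M| + 1)) (by positivity)] with n hn z hz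
  have h1 := hn z hz
  rw [Pi.zero_apply, dist_zero_left] at h1 ⊢
  calc ‖κ n z‖ ≤ C z * ‖entry (Ring.inverse (z • B - A)) n 0‖ := hκ n z
    _ ≤ (|M| + 1) * ‖entry (Ring.inverse (z • B - A)) n 0‖ := by
        gcongr
        have := hM z hz
        have h2 := le_abs_self (C z)
        have h3 := le_abs_self M
        rw [Real.norm_eq_abs] at this
        linarith
    _ < (|M| + 1) * (ε / (|M| + 1)) := by gcongr; exact h1
    _ = ε := by field_simp

/-! ### From error formulas to convergence in capacity. -/

/-- Convergence in capacity follows from an error formula with a normal denominator and a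
numerator which tends to zero. -/
theorem tendstoInCapacity_of_error_mul {V : Set ℂ} (hVc : IsClosed V) (hV : IsPreconnected V)
    (hVρ : V ⊆ resolventSet A B) {P Q : ℕ → ℂ[X]} (hQ : ∀ n, Q n ≠ 0) {f κ : ℕ → ℂ → ℂ}
    (hd : ∀ n, ∀ z ∈ resolventSet A B, DifferentiableAt ℂ (f n) z)
    (hf : ∀ z ∈ resolventSet A B, EquicontinuousAt f z)
    (hb : ∀ z ∈ resolventSet A B, ∃ M : ℝ, ∀ n, ‖f n z‖ ≤ M)
    {z₀ : ℂ} (hz₀ : z₀ ∈ V) {c : ℝ} (hc : 0 < c) (hfc : ∀ n, c ≤ ‖f n z₀‖)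
    (hκ : ∀ K ⊆ resolventSet A B, IsCompact K → TendstoUniformlyOn κ 0 atTop K)
    (hrel : ∀ n, ∀ z ∈ V, ((Q n).eval z * mFun A B z - (P n).eval z) * f n z =
      (Q n).eval z * κ n z)
    (hinf : ∀ η : ℝ, 0 < η → ∃ ρ : ℝ, ∀ n, ∀ z ∈ V, ρ < ‖z‖ → ‖κ n z‖ < η * ‖f n z‖) :
    TendstoInCapacity P Q (mFun A B) V := by
  intro η hη
  obtain ⟨ρ, hρ⟩ := hinf η hη
  -- The resolvent set may be disconnected; nondegeneracy at z₀ gives information only on the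
  -- component of z₀, which contains V.
  have hUρ : connectedComponentIn (resolventSet A B) z₀ ⊆ resolventSet A B :=
    connectedComponentIn_subset _ _
  have hVU : V ⊆ connectedComponentIn (resolventSet A B) z₀ :=
    hV.subset_connectedComponentIn hz₀ hVρ
  have hK : IsCompact (V ∩ Metric.closedBall 0 ρ) := (isCompact_closedBall 0 ρ).inter_left hVc
  have hKU := (Set.inter_subset_left (t := Metric.closedBall 0 ρ)).trans hVU
  have hg : TendstoUniformlyOn (fun n z => ‖κ n z‖ / η) 0 atTop (V ∩ Metric.closedBall 0 ρ) := by
    have h := Metric.tendstoUniformlyOn_iff.1 (hκ _ (hKU.trans hUρ) hK)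
    refine Metric.tendstoUniformlyOn_iff.2 fun ε hε => ?_
    filter_upwards [h (ε * η) (by positivity)] with n hn z hz
    have h1 := hn z hz
    rw [Pi.zero_apply, dist_zero_left] at h1 ⊢
    rw [Real.norm_of_nonneg (by positivity), div_lt_iff₀ hη]
    exact h1
  refine tendsto_capacity_of_normal isOpen_resolventSet.connectedComponentIn
    isPreconnected_connectedComponentIn
    (fun n z hz => (hd n z (hUρ hz)).differentiableWithinAt) (fun z hz => hf z (hUρ hz))
    (fun z hz => hb z (hUρ hz)) (hVU hz₀) hc hfc hK hKU hg
    (fun n => Polynomial.finite_setOfPred_isRoot (hQ n)) ?_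
  rintro n z ⟨hzV, hz⟩
  by_cases hQz : (Q n).eval z = 0
  · exact Or.inl hQz
  have hz := hz.resolve_left hQz
  have hκz : (mFun A B z - (P n).eval z / (Q n).eval z) * f n z = κ n z := by
    have := hrel n z hzV
    field_simp
    linear_combination this
  -- At a bad point the denominator is dominated by the numerator divided by η; by `hρ` this
  -- confines the point to a compact part of V.
  have hle : η * ‖f n z‖ ≤ ‖κ n z‖ := by
    rw [← hκz, norm_mul]
    gcongr
  have hzρ : ‖z‖ ≤ ρ := by
    by_contra! h
    exact absurd (hρ n z hzV h) (not_lt.2 hle)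
  refine Or.inr ⟨⟨hzV, by simpa using hzρ⟩, ?_⟩
  rw [le_div_iff₀ hη]
  linarith

/-! ### Behaviour of the error terms near infinity. -/

section Infinity

lemma tendsto_inv_smul_pencil :
    Tendsto (fun z : ℂ => B - z⁻¹ • A) (Bornology.cobounded ℂ) (𝓝 B) := by
  simpa using (tendsto_const_nhds (x := B)).sub ((tendsto_inv₀_cobounded (α := ℂ)).smul_const A)

lemma inv_smul_pencil {z : ℂ} (hz : z ≠ 0) : z⁻¹ • (z • B - A) = B - z⁻¹ • A := by
  rw [smul_sub, inv_smul_smul₀ hz]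

lemma inverse_inv_smul_pencil {z : ℂ} (hz : z ≠ 0) (hzρ : z ∈ resolventSet A B) :
    z • Ring.inverse (z • B - A) = Ring.inverse (B - z⁻¹ • A) := by
  rw [← inv_smul_pencil hz, ← one_mul (Ring.inverse (z⁻¹ • _)), Ring.eq_mul_inverse_iff_mul_eq]
  · rw [smul_mul_smul_comm, mul_inv_cancel₀ hz, one_smul, Ring.inverse_mul_cancel _ hzρ]
  · exact (hzρ : IsUnit (z • B - A)).smul (Units.mk0 z⁻¹ (inv_ne_zero hz))

lemma tendsto_inverse_inv_smul_pencil (hB : IsUnit B) :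
    Tendsto (fun z : ℂ => Ring.inverse (B - z⁻¹ • A)) (Bornology.cobounded ℂ)
      (𝓝 (Ring.inverse B)) := by
  obtain ⟨u, rfl⟩ := hB
  exact (NormedRing.inverse_continuousAt u).tendsto.comp tendsto_inv_smul_pencil

lemma tendsto_norm_inverse_pencil (hB : IsUnit B) :
    Tendsto (fun z : ℂ => ‖z⁻¹ • Ring.inverse (B - z⁻¹ • A)‖) (Bornology.cobounded ℂ) (𝓝 0) := by
  simpa using ((tendsto_inv₀_cobounded (α := ℂ)).smul
    (tendsto_inverse_inv_smul_pencil (A := A) hB)).norm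

lemma eventually_cobounded_iff {P : ℂ → Prop} :
    (∀ᶠ z in Bornology.cobounded ℂ, P z) ↔ ∃ ρ : ℝ, 0 < ρ ∧ ∀ z, ρ < ‖z‖ → P z := by
  rw [← comap_norm_atTop, ((atTop_basis_Ioi' (0 : ℝ)).comap _).eventually_iff]
  exact ⟨fun ⟨r, hr, h⟩ => ⟨r, hr, fun z hz => h hz⟩, fun ⟨r, hr, h⟩ => ⟨r, hr, fun z hz => h z hz⟩⟩

/-- The pencil scales by z and the resolvent by 1/z, so the product has a limit at infinity,
obtained by replacing the pencil with B. -/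
lemma offDiag_eq {z : ℂ} (hz : z ≠ 0) (hzρ : z ∈ resolventSet A B) (n : ℕ) :
    offDiag A B n z = -(entry (B - z⁻¹ • A) (n + 1) n *
      entry (Ring.inverse (B - z⁻¹ • A)) n (n + 1)) := by
  rw [← inverse_inv_smul_pencil hz hzρ, ← inv_smul_pencil hz, entry_smul, entry_smul, offDiag]
  field_simp

/-- If `B` is invertible then the functions `offDiag n` are equicontinuous at infinity. -/
lemma exists_norm_offDiag_sub_le (hB : IsUnit B) {ε : ℝ} (hε : 0 < ε) :
    ∃ ρ : ℝ, ∀ z ∈ resolventSet A B, ∀ w ∈ resolventSet A B, ρ < ‖z‖ → ρ < ‖w‖ →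
      ∀ n, ‖offDiag A B n z - offDiag A B n w‖ ≤ ε := by
  have h := tendsto_norm_sub_mul_add (tendsto_inv_smul_pencil (A := A) (B := B))
    (tendsto_inverse_inv_smul_pencil (A := A) hB)
  obtain ⟨ρ, hρ0, hρ⟩ := eventually_cobounded_iff.1 (h.eventually (gt_mem_nhds (half_pos hε)))
  have key : ∀ z ∈ resolventSet A B, ρ < ‖z‖ → ∀ n, ‖offDiag A B n z -
      -(entry B (n + 1) n * entry (Ring.inverse B) n (n + 1))‖ ≤ ε / 2 := by
    intro z hz hzρ n
    rw [offDiag_eq (norm_pos_iff.1 (hρ0.trans hzρ)) hz, neg_sub_neg, norm_sub_rev]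
    exact (norm_entry_mul_sub_le _ _ _ _ _ _ _ _).trans (hρ z hzρ).le
  refine ⟨ρ, fun z hz w hw hzρ hwρ n => ?_⟩
  have h1 := key z hz hzρ n
  have h2 := key w hw hwρ n
  rw [norm_sub_rev] at h2
  have h3 := norm_sub_le_norm_sub_add_norm_sub (offDiag A B n z)
    (-(entry B (n + 1) n * entry (Ring.inverse B) n (n + 1))) (offDiag A B n w)
  linarith

/-- Two resolvent factors against one pencil factor give decay like 1/z, uniformly in n. -/
lemma exists_norm_offDiagNum_lt (hB : IsUnit B) {ε : ℝ} (hε : 0 < ε) :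
    ∃ ρ : ℝ, ∀ z ∈ resolventSet A B, ρ < ‖z‖ → ∀ n, ‖offDiagNum A B n z‖ < ε := by
  have h := ((tendsto_inv_smul_pencil (A := A) (B := B)).norm.mul
    (tendsto_inverse_inv_smul_pencil (A := A) hB).norm).mul
    (tendsto_norm_inverse_pencil (A := A) hB)
  rw [mul_zero] at h
  obtain ⟨ρ, hρ0, hρ⟩ := eventually_cobounded_iff.1 (h.eventually (gt_mem_nhds hε))
  refine ⟨ρ, fun z hz hzρ n => lt_of_le_of_lt ?_ (hρ z hzρ)⟩
  have hz0 : z ≠ 0 := norm_pos_iff.1 (hρ0.trans hzρ)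
  rw [← inverse_inv_smul_pencil hz0 hz, ← inv_smul_pencil hz0, inv_smul_smul₀ hz0, norm_smul,
    norm_smul, norm_inv]
  refine (norm_offDiagNum_le n z).trans ?_
  have hn : ‖z‖ ≠ 0 := norm_ne_zero_iff.2 hz0
  calc _ ≤ ‖z • B - A‖ * ‖Ring.inverse (z • B - A)‖ * ‖Ring.inverse (z • B - A)‖ := by
        gcongr; exact norm_entry_le _ _ _
    _ = _ := by field_simp

/-- Two resolvent factors decay like 1/z², which beats the lower bound of order 1/z for the diagonal
entries. -/
lemma exists_norm_mul_diagNum_lt (hB : IsUnit B) {ε : ℝ} (hε : 0 < ε) :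
    ∃ ρ : ℝ, ∀ z ∈ resolventSet A B, ρ < ‖z‖ → ∀ n, ‖z‖ * ‖diagNum A B n z‖ < ε := by
  have h := (tendsto_inverse_inv_smul_pencil (A := A) hB).norm.mul
    (tendsto_norm_inverse_pencil (A := A) hB)
  rw [mul_zero] at h
  obtain ⟨ρ, hρ0, hρ⟩ := eventually_cobounded_iff.1 (h.eventually (gt_mem_nhds hε))
  refine ⟨ρ, fun z hz hzρ n => lt_of_le_of_lt ?_ (hρ z hzρ)⟩
  have hz0 : z ≠ 0 := norm_pos_iff.1 (hρ0.trans hzρ)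
  rw [← inverse_inv_smul_pencil hz0 hz, inv_smul_smul₀ hz0, norm_smul, mul_assoc]
  gcongr
  exact (norm_diagNum_le n z).trans (by gcongr; exact norm_entry_le _ _ _)

end Infinity

/-! ### Lower bounds from the numerical ranges. -/

section NumericalRange

/-- For y = T⁻¹ e_n the form ⟨Ty, y⟩ is, up to conjugation, the n-th diagonal entry of T⁻¹, and ‖y‖
≥ 1/‖T‖. -/
lemma le_norm_entry_inverse {T : Ell2 →L[ℂ] Ell2} (hT : IsUnit T) {c : ℝ} (hc : 0 ≤ c)
    (h : ∀ y, c * ‖y‖ ^ 2 ≤ ‖inner ℂ y (T y)‖) (n : ℕ) :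
    c ≤ ‖T‖ ^ 2 * ‖entry (Ring.inverse T) n n‖ := by
  have hTy : T (Ring.inverse T (e n)) = e n := by
    rw [← mul_apply_eq_comp, Ring.mul_inverse_cancel _ hT]; rfl
  set y := Ring.inverse T (e n) with hy
  have h1 := h y
  rw [hTy, ← norm_inner_symm] at h1
  have h2 : 1 ≤ ‖T‖ * ‖y‖ := by
    have := T.le_opNorm y
    rwa [hTy, norm_e] at this
  calc c = c * 1 ^ 2 := by ring
    _ ≤ c * (‖T‖ * ‖y‖) ^ 2 := by gcongr
    _ = ‖T‖ ^ 2 * (c * ‖y‖ ^ 2) := by ring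
    _ ≤ _ := by gcongr; exact h1

lemma inner_smul_unit (T : Ell2 →L[ℂ] Ell2) {y : Ell2} (hy : y ≠ 0) :
    inner ℂ y (T y) = (‖y‖ : ℂ) ^ 2 *
      inner ℂ (((‖y‖ : ℂ)⁻¹) • y) (T (((‖y‖ : ℂ)⁻¹) • y)) := by
  have : (‖y‖ : ℂ) ≠ 0 := by simpa using hy
  rw [map_smul, inner_smul_left, inner_smul_right, map_inv₀, Complex.conj_ofReal]
  field_simp

lemma exists_le_norm_inner_of_notMem_closure (h : (0 : ℂ) ∉ closure (Theta B)) :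
    ∃ c : ℝ, 0 < c ∧ ∀ y, c * ‖y‖ ^ 2 ≤ ‖inner ℂ y (B y)‖ := by
  rw [Metric.mem_closure_iff] at h
  push Not at h
  obtain ⟨c, hc, h⟩ := h
  refine ⟨c, hc, fun y => ?_⟩
  rcases eq_or_ne y 0 with rfl | hy
  · simp
  have hy' : ‖y‖ ≠ 0 := norm_ne_zero_iff.2 hy
  have h1 := h _ ⟨((‖y‖ : ℂ)⁻¹) • y, by simp [norm_smul, hy'], rfl⟩
  rw [dist_zero_left] at h1
  rw [inner_smul_unit B hy, norm_mul, norm_pow, Complex.norm_real, norm_norm, mul_comm]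
  gcongr

lemma inner_pencil (z : ℂ) (y : Ell2) :
    inner ℂ y ((z • B - A) y) = z * inner ℂ y (B y) - inner ℂ y (A y) := by
  rw [sub_apply, smul_apply, inner_sub_right, inner_smul_right]

/-- The form of the pencil factors as (z - w)⟨By, y⟩ with w = ⟨Ay, y⟩/⟨By, y⟩ in W(A,B), and both
factors are bounded below. -/
lemma exists_le_norm_inner_pencil (h : (0 : ℂ) ∉ closure (Theta B)) {z : ℂ}
    (hz : z ∉ closure (W A B)) :
    ∃ c : ℝ, 0 < c ∧ ∀ y, c * ‖y‖ ^ 2 ≤ ‖inner ℂ y ((z • B - A) y)‖ := by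
  obtain ⟨c, hc, hcB⟩ := exists_le_norm_inner_of_notMem_closure h
  rw [Metric.mem_closure_iff] at hz
  push Not at hz
  obtain ⟨d, hd, hz⟩ := hz
  refine ⟨d * c, by positivity, fun y => ?_⟩
  rcases eq_or_ne y 0 with rfl | hy
  · simp
  have hBy : inner ℂ y (B y) ≠ 0 := by
    have h1 := hcB y
    have h2 : 0 < c * ‖y‖ ^ 2 := by positivity
    exact norm_pos_iff.1 (h2.trans_le h1)
  have h1 := hz (inner ℂ y (A y) / inner ℂ y (B y)) ⟨y, hy, by
    rw [inner_pencil]; field_simp; ring⟩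
  have h2 : inner ℂ y ((z • B - A) y) =
      (z - inner ℂ y (A y) / inner ℂ y (B y)) * inner ℂ y (B y) := by
    rw [inner_pencil]; field_simp
  rw [h2, norm_mul, mul_assoc, ← dist_eq_norm]
  exact mul_le_mul h1 (hcB y) (by positivity) dist_nonneg

/-- If the numerical range of `B` stays away from zero then the diagonal entries of the resolvent
decay at infinity not faster than `1 / z`. -/
lemma exists_le_norm_mul_diag (h : (0 : ℂ) ∉ closure (Theta B)) :
    ∃ c : ℝ, 0 < c ∧ ∃ ρ : ℝ, ∀ z ∈ resolventSet A B, ρ < ‖z‖ → ∀ n,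
      c ≤ ‖z‖ * ‖diag A B n z‖ := by
  obtain ⟨c, hc, hcB⟩ := exists_le_norm_inner_of_notMem_closure h
  -- For ‖z‖ > 2‖A‖/c the term in A costs at most half of the lower bound c‖z‖ of the form; for ‖z‖
  -- > 1 the pencil has norm at most ‖z‖(‖B‖ + ‖A‖).
  refine ⟨c / 2 / (‖B‖ + ‖A‖) ^ 2, ?_, max 1 (2 * ‖A‖ / c), fun z hz hzρ n => ?_⟩
  · have hB0 : 0 < ‖B‖ := by
      refine norm_pos_iff.2 fun h0 => ?_
      have := hcB (e 0)
      rw [h0, norm_e] at this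
      simp at this
      linarith
    positivity
  obtain ⟨hz1, hz2⟩ := max_lt_iff.1 hzρ
  rw [div_lt_iff₀ hc] at hz2
  have hco : ∀ y, ‖z‖ * (c / 2) * ‖y‖ ^ 2 ≤ ‖inner ℂ y ((z • B - A) y)‖ := fun y => by
    have h1 := norm_sub_norm_le (z * inner ℂ y (B y)) (inner ℂ y (A y))
    rw [← inner_pencil, norm_mul] at h1
    have h2 : ‖inner ℂ y (A y)‖ ≤ ‖A‖ * ‖y‖ ^ 2 := by
      refine (norm_inner_le_norm _ _).trans ?_
      calc ‖y‖ * ‖A y‖ ≤ ‖y‖ * (‖A‖ * ‖y‖) := by gcongr; exact A.le_opNorm y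
        _ = _ := by ring
    have h3 : ‖z‖ * (c * ‖y‖ ^ 2) ≤ ‖z‖ * ‖inner ℂ y (B y)‖ := by gcongr; exact hcB y
    have h4 : 2 * ‖A‖ * ‖y‖ ^ 2 ≤ ‖z‖ * c * ‖y‖ ^ 2 := by gcongr
    linarith
  have h5 := le_norm_entry_inverse hz (by positivity) hco n
  have h6 : ‖z • B - A‖ ≤ ‖z‖ * (‖B‖ + ‖A‖) := by
    refine (norm_sub_le _ _).trans ?_
    rw [norm_smul, mul_add]
    gcongr
    exact le_mul_of_one_le_left (norm_nonneg _) hz1.le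
  have hz0 : 0 < ‖z‖ := one_pos.trans hz1
  have h7 : ‖z‖ * (c / 2) ≤ (‖z‖ * (‖B‖ + ‖A‖)) ^ 2 * ‖diag A B n z‖ := by
    refine h5.trans ?_
    rw [diag]
    gcongr
  refine div_le_of_le_mul₀ (by positivity) (by positivity) ?_
  refine le_of_mul_le_mul_left ?_ hz0
  linarith

end NumericalRange

/-! ### Nonvanishing denominators and the two convergence statements. -/

/-- A continuous function on the resolvent set which vanishes off the zeros of a polynomial. -/
lemma eq_zero_of_eval_mul_eq_zero {P : ℂ[X]} (hP : P ≠ 0) {f : ℂ → ℂ}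
    (hf : ∀ z ∈ resolventSet A B, ContinuousAt f z)
    (h : ∀ z ∈ resolventSet A B, P.eval z * f z = 0) {z : ℂ} (hz : z ∈ resolventSet A B) :
    f z = 0 := by
  have h1 : ∀ᶠ w in 𝓝[≠] z, f w = 0 := by
    filter_upwards [nhdsNE_le_cofinite z
        (Polynomial.finite_setOfPred_isRoot hP).compl_mem_cofinite,
      mem_nhdsWithin_of_mem_nhds (isOpen_resolventSet.mem_nhds hz)] with w hw1 hw2
    exact (mul_eq_zero.1 (h w hw2)).resolve_left hw1
  have h2 : Tendsto f (𝓝[≠] z) (𝓝 (f z)) := (hf z hz).tendsto.mono_left nhdsWithin_le_nhds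
  exact tendsto_nhds_unique (h2.congr' h1) tendsto_const_nhds


variable {A B : Ell2 →L[ℂ] Ell2}

lemma prodL_ne_zero (h : ∀ n, alphaL A B n ≠ 0) (n : ℕ) : prodL A B n ≠ 0 :=
  Finset.prod_ne_zero_iff.2 fun j _ => h j

lemma prodR_ne_zero (h : ∀ n, alphaR A B n ≠ 0) (n : ℕ) : prodR A B n ≠ 0 :=
  Finset.prod_ne_zero_iff.2 fun j _ => h j

/-- If q_n were the zero polynomial, S_{nn} would vanish off the zeros of `prodL`, hence everywhere
by continuity. The next two lemmas argue in the same way. -/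
lemma q_ne_zero_of_diag_ne_zero (hA : IsTridiagonal A) (hB : IsTridiagonal B)
    (hL : ∀ n, alphaL A B n ≠ 0) {z : ℂ} (hz : z ∈ resolventSet A B) {n : ℕ}
    (h : diag A B n z ≠ 0) : q A B n ≠ 0 := fun hq => h <|
  eq_zero_of_eval_mul_eq_zero (prodL_ne_zero hL n)
    (fun _ hw => (differentiableAt_diag hw n).continuousAt)
    (fun w hw => by rw [prodL_mul_diag hA hB hw, hq, eval_zero, zero_mul]) hz

lemma q_ne_zero_of_offDiag_ne_zero (hA : IsTridiagonal A) (hB : IsTridiagonal B)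
    (hR : ∀ n, alphaR A B n ≠ 0) {z : ℂ} (hz : z ∈ resolventSet A B) {n : ℕ}
    (h : offDiag A B n z ≠ 0) : q A B n ≠ 0 := fun hq => h <|
  eq_zero_of_eval_mul_eq_zero (prodR_ne_zero hR n)
    (fun _ hw => (differentiableAt_offDiag hw n).continuousAt)
    (fun w hw => by rw [prodR_mul_offDiag hA hB hw, hq, eval_zero, zero_mul]) hz

lemma q_succ_ne_zero_of_one_add_offDiag_ne_zero (hA : IsTridiagonal A) (hB : IsTridiagonal B)
    (hL : ∀ n, alphaL A B n ≠ 0) {z : ℂ} (hz : z ∈ resolventSet A B) {n : ℕ}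
    (h : 1 + offDiag A B n z ≠ 0) : q A B (n + 1) ≠ 0 := fun hq => h <|
  eq_zero_of_eval_mul_eq_zero (f := fun z => 1 + offDiag A B n z) (prodL_ne_zero hL n)
    (fun _ hw => ((differentiableAt_offDiag hw n).const_add 1).continuousAt)
    (fun w hw => by rw [prodL_mul_one_add_offDiag hA hB hw, hq, eval_zero, zero_mul]) hz

lemma tendstoUniformlyOn_offDiagNum {K : Set ℂ} (hKρ : K ⊆ resolventSet A B)
    (hK : IsCompact K) : TendstoUniformlyOn (offDiagNum A B) 0 atTop K :=
  tendstoUniformlyOn_of_norm_le hK hKρ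
    (fun _ hz => ((differentiable_pencil _).continuousAt.norm.mul
      (differentiableAt_inverse_pencil (hKρ hz)).continuousAt.norm).continuousWithinAt)
    norm_offDiagNum_le

lemma tendstoUniformlyOn_diagNum {K : Set ℂ} (hKρ : K ⊆ resolventSet A B)
    (hK : IsCompact K) : TendstoUniformlyOn (diagNum A B) 0 atTop K :=
  tendstoUniformlyOn_of_norm_le hK hKρ
    (fun _ hz => (differentiableAt_inverse_pencil (hKρ hz)).continuousAt.norm.continuousWithinAt)
    norm_diagNum_le

lemma exists_mem_lt_norm {V : Set ℂ} (hV : ¬ Bornology.IsBounded V) (ρ : ℝ) :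
    ∃ z ∈ V, ρ < ‖z‖ := by
  by_contra! h
  exact hV ((Metric.isBounded_closedBall (x := (0 : ℂ)) (r := ρ)).subset fun z hz => by
    simpa using h z hz)

/-- There is a reference point such that the values of `offDiag` there control those near
infinity. -/
lemma exists_reference_point {V : Set ℂ} (hV : V.Nonempty) (hVρ : V ⊆ resolventSet A B)
    (hinf : ¬ Bornology.IsBounded V → IsUnit B) :
    ∃ z₀ ∈ V, ∃ ρ : ℝ, ∀ z ∈ V, ρ < ‖z‖ →
      ∀ n, ‖offDiag A B n z - offDiag A B n z₀‖ ≤ 1 / 4 := by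
  by_cases hVb : Bornology.IsBounded V
  · obtain ⟨z₀, hz₀⟩ := hV
    obtain ⟨ρ, hρ⟩ := hVb.exists_norm_le
    exact ⟨z₀, hz₀, ρ, fun z hz h => absurd (hρ z hz) (not_le.2 h)⟩
  -- The tolerance 1/4 is half of the bound 1/2 in `exists_shift_le_norm`. Taking z₀ itself near
  -- infinity lets one choice of shifts serve at z₀ and near infinity.
  · obtain ⟨ρ, hρ⟩ := exists_norm_offDiag_sub_le (A := A) (hinf hVb)
      (show (0 : ℝ) < 1 / 4 by norm_num)
    obtain ⟨z₀, hz₀, hz₀ρ⟩ := exists_mem_lt_norm hVb ρ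
    exact ⟨z₀, hz₀, ρ, fun z hz h n => hρ z (hVρ hz) z₀ (hVρ hz₀) h hz₀ρ n⟩

lemma exists_shift_le_norm (w : ℂ) : ∃ ε : ℕ, (ε = 0 ∨ ε = 1) ∧ 1 / 2 ≤ ‖(ε : ℂ) + w‖ := by
  by_cases h : 1 / 2 ≤ ‖w‖
  · exact ⟨0, Or.inl rfl, by simpa using h⟩
  · refine ⟨1, Or.inr rfl, ?_⟩
    have h1 := norm_sub_le ((1 : ℂ) + w) w
    rw [add_sub_cancel_right, norm_one] at h1
    push_cast
    linarith

theorem exists_shift_tendstoInCapacity (hA : IsTridiagonal A) (hB : IsTridiagonal B)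
    (hL : ∀ n, alphaL A B n ≠ 0) (hR : ∀ n, alphaR A B n ≠ 0) {V : Set ℂ} (hVc : IsClosed V)
    (hV : IsConnected V) (hVρ : V ⊆ resolventSet A B)
    (hinf : ¬ Bornology.IsBounded V → IsUnit B) :
    ∃ ε : ℕ → ℕ, (∀ n, ε n = 0 ∨ ε n = 1) ∧ (∀ n, q A B (n + ε n) ≠ 0) ∧
      TendstoInCapacity (fun n => p A B (n + ε n)) (fun n => q A B (n + ε n)) (mFun A B) V := by
  obtain ⟨z₀, hz₀, ρ, hρ⟩ := exists_reference_point hV.nonempty hVρ hinf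
  choose ε hε hεle using fun n => exists_shift_le_norm (offDiag A B n z₀)
  have hq : ∀ n, q A B (n + ε n) ≠ 0 := by
    intro n
    have h1 : (ε n : ℂ) + offDiag A B n z₀ ≠ 0 :=
      norm_pos_iff.1 (lt_of_lt_of_le (by norm_num) (hεle n))
    rcases hε n with h | h
    · rw [h, Nat.cast_zero, zero_add] at h1
      rw [h]
      exact q_ne_zero_of_offDiag_ne_zero hA hB hR (hVρ hz₀) h1
    · rw [h, Nat.cast_one] at h1
      rw [h]
      exact q_succ_ne_zero_of_one_add_offDiag_ne_zero hA hB hL (hVρ hz₀) h1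
  refine ⟨ε, hε, hq, tendstoInCapacity_of_error_mul hVc hV.isPreconnected hVρ hq
    (f := fun n z => (ε n : ℂ) + offDiag A B n z) (κ := offDiagNum A B)
    (fun n z hz => (differentiableAt_offDiag hz n).const_add _)
    (fun z hz => equicontinuousAt_add_offDiag hz _) (fun z _ => ?_) hz₀ one_half_pos hεle
    (fun K => tendstoUniformlyOn_offDiagNum) (fun n z hz => ?_) (fun η hη => ?_)⟩
  · refine ⟨1 + ‖z • B - A‖ * ‖Ring.inverse (z • B - A)‖, fun n => (norm_add_le _ _).trans
      (add_le_add ?_ (norm_offDiag_le n z))⟩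
    rcases hε n with h | h <;> simp [h]
  · rcases hε n with h | h
    · simp only [h, Nat.cast_zero, zero_add, add_zero]
      exact error_mul_offDiag hA hB (hVρ hz) n
    · simp only [h, Nat.cast_one]
      exact error_mul_one_add_offDiag hA hB (hVρ hz) n
  · by_cases hVb : Bornology.IsBounded V
    · obtain ⟨r, hr⟩ := hVb.exists_norm_le
      exact ⟨r, fun n z hz h => absurd (hr z hz) (not_le.2 h)⟩
    · obtain ⟨r, hr⟩ := exists_norm_offDiagNum_lt (A := A) (hinf hVb)
        (show (0 : ℝ) < η * (1 / 4) by positivity)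
      -- Beyond this radius the denominators have modulus at least 1/2 - 1/4 = 1/4.
      refine ⟨max ρ r, fun n z hz h => (hr z (hVρ hz) ((le_max_right _ _).trans_lt h) n).trans_le ?_⟩
      gcongr
      have h1 := hρ z hz ((le_max_left _ _).trans_lt h) n
      have h2 := hεle n
      have h3 := norm_sub_norm_le ((ε n : ℂ) + offDiag A B n z₀) ((ε n : ℂ) + offDiag A B n z)
      rw [add_sub_add_left_eq_sub, norm_sub_rev] at h3
      linarith

theorem tendstoInCapacity_of_zero_notMem_closure (hA : IsTridiagonal A) (hB : IsTridiagonal B)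
    (hL : ∀ n, alphaL A B n ≠ 0) {V : Set ℂ} (hVc : IsClosed V)
    (hV : IsPreconnected V) (hVρ : V ⊆ resolventSet A B)
    (hinf : ¬ Bornology.IsBounded V → IsUnit B) (hΘ : (0 : ℂ) ∉ closure (Theta B))
    (hW : ¬ V ⊆ closure (W A B)) :
    (∀ n, q A B n ≠ 0) ∧ TendstoInCapacity (p A B) (q A B) (mFun A B) V := by
  obtain ⟨z₀, hz₀, hz₀W⟩ := Set.not_subset.1 hW
  obtain ⟨c, hc, hcT⟩ := exists_le_norm_inner_pencil hΘ hz₀W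
  have hle := le_norm_entry_inverse (hVρ hz₀) hc.le hcT
  have hT : 0 < ‖z₀ • B - A‖ ^ 2 := by
    refine lt_of_le_of_ne (by positivity) fun h => ?_
    have := hle 0
    rw [← h, zero_mul] at this
    linarith
  have hd : ∀ n, c / ‖z₀ • B - A‖ ^ 2 ≤ ‖diag A B n z₀‖ := fun n => by
    rw [div_le_iff₀' hT]
    exact hle n
  have hq : ∀ n, q A B n ≠ 0 := fun n => q_ne_zero_of_diag_ne_zero hA hB hL (hVρ hz₀)
    (norm_pos_iff.1 ((div_pos hc hT).trans_le (hd n)))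
  refine ⟨hq, tendstoInCapacity_of_error_mul hVc hV hVρ hq (f := diag A B) (κ := diagNum A B)
    (fun n z hz => differentiableAt_diag hz n)
    (fun z hz => equicontinuousAt_entry_inverse hz id id) (fun z _ => ⟨_, fun n => norm_diag_le n z⟩)
    hz₀ (div_pos hc hT) hd (fun K => tendstoUniformlyOn_diagNum)
    (fun n z hz => error_mul_diag hA hB (hVρ hz) n) (fun η hη => ?_)⟩
  by_cases hVb : Bornology.IsBounded V
  · obtain ⟨r, hr⟩ := hVb.exists_norm_le
    exact ⟨r, fun n z hz h => absurd (hr z hz) (not_le.2 h)⟩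
  · obtain ⟨a, ha, ρ, hρ⟩ := exists_le_norm_mul_diag (A := A) hΘ
    obtain ⟨r, hr⟩ := exists_norm_mul_diagNum_lt (A := A) (hinf hVb)
      (show (0 : ℝ) < η * a by positivity)
    refine ⟨max ρ r, fun n z hz h => ?_⟩
    have h1 := hρ z (hVρ hz) ((le_max_left _ _).trans_lt h) n
    have h2 := hr z (hVρ hz) ((le_max_right _ _).trans_lt h) n
    -- Numerator and denominator are compared after multiplication by ‖z‖: the former is below η a,
    -- the latter at least a.
    have h3 : η * a ≤ η * (‖z‖ * ‖diag A B n z‖) := by gcongr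
    refine lt_of_mul_lt_mul_left (a := ‖z‖) ?_ (norm_nonneg z)
    linarith

end Pencil

theorem theorem3p6 (A B : Pencil.Ell2 →L[ℂ] Pencil.Ell2)
    (hA : Pencil.IsTridiagonal A) (hB : Pencil.IsTridiagonal B)
    (hbeta : ∀ n, Pencil.beta A B n ≠ 0)
    (halphaL : ∀ n, Pencil.alphaL A B n ≠ 0)
    (halphaR : ∀ n, Pencil.alphaR A B n ≠ 0)
    (V : Set ℂ) (hVclosed : IsClosed V) (hVconn : IsConnected V)
    (hVbdry : IsCompact (frontier V)) (hVres : V ⊆ Pencil.resolventSet A B)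
    -- an unbounded `V` contains a neighbourhood of `∞`, and `∞ ∈ ρ(A, B)` means that `B` is
    -- boundedly invertible
    (hVinf : ¬ Bornology.IsBounded V → IsUnit B) :
    (∃ ε : ℕ → ℕ, (∀ n, ε n = 0 ∨ ε n = 1) ∧
      (∀ n, Pencil.q A B (n + ε n) ≠ 0) ∧
      Pencil.TendstoInCapacity (fun n => Pencil.p A B (n + ε n)) (fun n => Pencil.q A B (n + ε n))
        (Pencil.mFun A B) V) ∧
    ((0 : ℂ) ∉ closure (Pencil.Theta B) → ¬ V ⊆ closure (Pencil.W A B) →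
      (∀ n, Pencil.q A B n ≠ 0) ∧
      Pencil.TendstoInCapacity (Pencil.p A B) (Pencil.q A B) (Pencil.mFun A B) V) :=
  ⟨Pencil.exists_shift_tendstoInCapacity hA hB halphaL halphaR hVclosed hVconn hVres hVinf,
    Pencil.tendstoInCapacity_of_zero_notMem_closure hA hB halphaL hVclosed hVconn.isPreconnected
      hVres hVinf⟩
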